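/- Let $n\in\{5,7,9,\ldots,19\}$ be odd, let $\kappa>0$ and $s\neq 0$ be real numbers with $\frac{|s|}{\kappa}\le\frac1n$, and let $Q=Q(n,\kappa,s)=(q_{ij})$ be the skew-symmetric real $n\times n$ matrix given for $i<j$ by $$q_{ij}=\begin{cases}\kappa & \text{if } 1\le j-i\le \frac{n-1}{2},\\ -\kappa & \text{if } \frac{n+1}{2}\le j-i\le n-2,\\ -2\kappa+s & \text{if } (i,j)=(1,n),\end{cases}$$ with $q_{ii}=0$ and $q_{ij}=-q_{ji}$ for $i>j$. For $j=1,\ldots,n$ let $Q_j$ denote the matrix obtained from $Q$ by replacing its $j$-th column with the all-ones column vector $\mathbf 1$. Then every $Q_j$ is non-singular, there is exactly one vector $\pi\in\mathbb R^n$ with $\sum_{i=1}^n\pi_i=1$ and $\pi^{\top}Q=\mathbf 0^{\top}$, and the quantity $$\varphi(Q)=\max_{j\in\{1,\ldots,n\}}\ \max_{i\in\{1,\ldots,n\}}\left|\left(\mathbf 1^{\top}Q_j^{-1}-\pi^{\top}\right)_i\right|$$ satisfies $$\varphi(Q)\le\frac{4n^2+1}{3|s|}.$$ -/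

import Mathlib

/-- The affine hyperplane `S_n` of vectors `x ∈ ℝⁿ` whose coordinates sum to `1`. -/
def sumOne (n : ℕ) : Set (Fin n → ℝ) := {x | ∑ i, x i = 1}

/-- The matrix `A_j`: the `j`-th column of `A` is replaced with the all-ones column vector. -/
def onesCol {n : ℕ} (A : Matrix (Fin n) (Fin n) ℝ) (j : Fin n) : Matrix (Fin n) (Fin n) ℝ :=
  A.updateCol j 1

/-- `φ(A) = max_j max_i |(1ᵀ A_j⁻¹ - π)_i|`, where `π` is to be the vector of `S_n`
with `πᵀ A = 0`. For `n ≥ 1` the suprema below are maxima over finite nonempty sets. -/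
noncomputable def varphi {n : ℕ} (A : Matrix (Fin n) (Fin n) ℝ) (π : Fin n → ℝ) : ℝ :=
  ⨆ j : Fin n, ⨆ i : Fin n, |(Matrix.vecMul 1 (onesCol A j)⁻¹ - π) i|

/-- The entries of `Q(n, κ, s)` above the diagonal, as a function of `d = j - i`
(so `1 ≤ d ≤ n - 1`, and `d = n - 1` is the upper right corner). -/
def upperEntry (n : ℕ) (κ s : ℝ) (d : ℕ) : ℝ :=
  if d ≤ (n - 1) / 2 then κ else if d ≤ n - 2 then -κ else -2 * κ + s

/-- The skew-symmetric `n × n` matrix `Q(n, κ, s)` (for odd `n ≥ 5`), with indices from `0`. -/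
def matQ (n : ℕ) (κ s : ℝ) : Matrix (Fin n) (Fin n) ℝ :=
  Matrix.of fun i j =>
    if i < j then upperEntry n κ s ((j : ℕ) - (i : ℕ))
    else if j < i then -upperEntry n κ s ((i : ℕ) - (j : ℕ))
    else 0

/-! Scaling reduces to `κ = 1`, with `t = s / κ` and `|t| ≤ 1/n`. Apart from its corners, `Q` is a
circulant sign matrix. In the full circulant, two cyclic rows at distance `(n-1)/2` add up to a
difference of two unit vectors; doubling modulo `n` makes such indices neighbours. This suggests
explicit formulas, affine in `t`, for a kernel vector `p` and a skew matrix `G` with `G Q = p 1ᵀ - σ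
I`, `G 1 = 0` and `σ = ∑ pᵢ = 4 + (n-4)t`. The transposed identity makes `π = p / σ` the unique
normalized null vector. Row `j` of `G Q` is constant off column `j`, hence `1ᵀ Q_j⁻¹ - πᵀ = G_j / (κ
p_j)`, where `G_j` is row `j` of `G`. Since `|G_ji| ≤ 3n` and `|p_j| ≥ |t|`, it follows that `φ ≤
3n/|s|`, which is stronger than required. -/

open Matrix

/-! ### Integer tables for the kernel vector and the generalized inverse -/

/-- The position of the index `i` when `0, …, n - 1` are reordered by doubling modulo `n`. -/
def pos (n i : ℕ) : ℕ := (2 * i + 2) % n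

/-- The function on pairs that is `f` above the diagonal and is extended skew-symmetrically. -/
def skewExt {R : Type*} [Zero R] [Neg R] (f : ℕ → ℕ → R) (a b : ℕ) : R :=
  if a < b then f a b else if b < a then -f b a else 0

/-- Constant coefficient of the kernel vector, at position `c`. -/
def kerConst (c : ℕ) : ℤ := if c = 1 then 2 else if c ≤ 2 then 1 else 0

/-- Linear coefficient of the kernel vector, at position `c`. -/
def kerLin (c : ℕ) : ℤ := if c = 1 then -1 else if c ≤ 2 then 0 else 1

/-- Constant coefficient of the generalized inverse, at positions `a < b`. -/
def ginvConst (n : ℕ) (a b : ℕ) : ℤ :=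
  if a = 0 then 2 * b - n
  else if a = 1 then (if b = 2 then 2 - n else 2 * (2 * b - n - 2))
  else if a = 2 then 2 * b - n - 4
  else -4

/-- Linear coefficient of the generalized inverse, at positions `a < b`. -/
def ginvLin (n : ℕ) (a b : ℕ) : ℤ :=
  if a = 0 then 0
  else if a = 1 then (if b = 2 then 0 else -(2 * b - n - 2))
  else if a = 2 then 0
  else 2 * (b - a) - (n - 4)

/-- Constant coefficient of `Q(n, 1, t)` above the diagonal. -/
def upperConst (n i j : ℕ) : ℤ :=
  if j - i ≤ (n - 1) / 2 then 1 else if j - i ≤ n - 2 then -1 else -2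

/-- Linear coefficient of `Q(n, 1, t)` above the diagonal. -/
def upperLin (n i j : ℕ) : ℤ :=
  if j - i ≤ (n - 1) / 2 then 0 else if j - i ≤ n - 2 then 0 else 1

def skewMat (n : ℕ) (f : ℕ → ℕ → ℤ) : Matrix (Fin n) (Fin n) ℤ :=
  Matrix.of fun i j => skewExt f i j

def skewMatPos (n : ℕ) (f : ℕ → ℕ → ℤ) : Matrix (Fin n) (Fin n) ℤ :=
  Matrix.of fun i j => skewExt f (pos n i) (pos n j)

/-- The integer identities which say that the kernel vector and the generalized inverse,
both affine in the parameter, do what their names promise. -/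
structure GinvIdentities (n : ℕ) : Prop where
  mul_const : ∀ i j : Fin n, (skewMatPos n (ginvConst n) * skewMat n (upperConst n)) i j =
    kerConst (pos n i) - if i = j then 4 else 0
  mul_lin : ∀ i j : Fin n, (skewMatPos n (ginvConst n) * skewMat n (upperLin n)) i j +
    (skewMatPos n (ginvLin n) * skewMat n (upperConst n)) i j =
    kerLin (pos n i) - if i = j then (n - 4 : ℤ) else 0
  mul_quad : ∀ i j : Fin n, (skewMatPos n (ginvLin n) * skewMat n (upperLin n)) i j = 0
  sum_const : ∀ i : Fin n, ∑ j, skewMatPos n (ginvConst n) i j = 0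
  sum_lin : ∀ i : Fin n, ∑ j, skewMatPos n (ginvLin n) i j = 0
  ker_const : ∀ j : Fin n, ∑ i : Fin n, kerConst (pos n i) * skewMat n (upperConst n) i j = 0
  ker_lin : ∀ j : Fin n, ∑ i : Fin n, (kerConst (pos n i) * skewMat n (upperLin n) i j +
    kerLin (pos n i) * skewMat n (upperConst n) i j) = 0
  ker_quad : ∀ j : Fin n, ∑ i : Fin n, kerLin (pos n i) * skewMat n (upperLin n) i j = 0
  ker_sum_const : ∑ i : Fin n, kerConst (pos n i) = 4
  ker_sum_lin : ∑ i : Fin n, kerLin (pos n i) = n - 4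

/-- A finite check for each of the eight odd `n`; this is where `n ≤ 19` enters. -/
theorem ginvIdentities {n : ℕ} (hodd : Odd n) (hn5 : 5 ≤ n) (hn19 : n ≤ 19) :
    GinvIdentities n := by
  interval_cases n <;> first
    | exact absurd hodd (by decide)
    | constructor <;> decide +kernel

/-- The kernel vector of `Q(n, 1, t)`, not normalized. -/
def kerVec (n : ℕ) (t : ℝ) (i : Fin n) : ℝ := kerConst (pos n i) + t * kerLin (pos n i)

/-- A skew-symmetric generalized inverse of `Q(n, 1, t)`, up to a scalar. -/
def ginv (n : ℕ) (t : ℝ) : Matrix (Fin n) (Fin n) ℝ :=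
  Matrix.of fun i j =>
    (skewMatPos n (ginvConst n) i j : ℝ) + t * (skewMatPos n (ginvLin n) i j : ℝ)

theorem matQ_one_apply {n : ℕ} (t : ℝ) (i j : Fin n) :
    matQ n 1 t i j =
      (skewMat n (upperConst n) i j : ℝ) + t * (skewMat n (upperLin n) i j : ℝ) := by
  simp only [matQ, skewMat, skewExt, Matrix.of_apply, Fin.lt_def, upperEntry, upperConst, upperLin]
  split_ifs <;> push_cast <;> ring

theorem matQ_mul {n : ℕ} (κ t : ℝ) : matQ n κ (κ * t) = κ • matQ n 1 t := by
  ext i j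
  simp only [matQ, upperEntry, Matrix.of_apply, Matrix.smul_apply, smul_eq_mul]
  split_ifs <;> ring

theorem matQ_transpose {n : ℕ} (κ s : ℝ) : (matQ n κ s)ᵀ = -matQ n κ s := by
  ext i j
  simp only [matQ, Matrix.transpose_apply, Matrix.neg_apply, Matrix.of_apply]
  rcases lt_trichotomy i j with h | h | h
  · simp [h, h.not_gt]
  · simp [h]
  · simp [h, h.not_gt]

theorem skewExt_swap (f : ℕ → ℕ → ℤ) (a b : ℕ) : skewExt f b a = -skewExt f a b := by
  unfold skewExt
  split_ifs <;> omega

theorem ginv_transpose {n : ℕ} (t : ℝ) : (ginv n t)ᵀ = -ginv n t := by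
  ext i j
  simp only [ginv, skewMatPos, Matrix.transpose_apply, Matrix.neg_apply, Matrix.of_apply]
  rw [skewExt_swap, skewExt_swap (ginvLin n)]
  push_cast
  ring

/-! ### Real matrix identities for every `t` -/

namespace GinvIdentities

variable {n : ℕ}

theorem ginv_mul (h : GinvIdentities n) (t : ℝ) :
    ginv n t * matQ n 1 t =
      Matrix.of (fun i _ => kerVec n t i) - (4 + (n - 4) * t) • (1 : Matrix (Fin n) (Fin n) ℝ) := by
  ext i j
  have h0 := congrArg (Int.cast : ℤ → ℝ) (h.mul_const i j)
  have h1 := congrArg (Int.cast : ℤ → ℝ) (h.mul_lin i j)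
  have h2 := congrArg (Int.cast : ℤ → ℝ) (h.mul_quad i j)
  simp only [Matrix.mul_apply] at h0 h1 h2
  push_cast at h0 h1 h2
  -- Both factors are affine in `t`, so the product is sorted by powers of `t`, one integer identity
  -- for each.
  have expand : (ginv n t * matQ n 1 t) i j =
      (∑ k, (skewMatPos n (ginvConst n) i k : ℝ) * (skewMat n (upperConst n) k j : ℝ)) +
      t * (∑ k, (skewMatPos n (ginvConst n) i k : ℝ) * (skewMat n (upperLin n) k j : ℝ) +
        ∑ k, (skewMatPos n (ginvLin n) i k : ℝ) * (skewMat n (upperConst n) k j : ℝ)) +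
      t ^ 2 * ∑ k, (skewMatPos n (ginvLin n) i k : ℝ) * (skewMat n (upperLin n) k j : ℝ) := by
    rw [Matrix.mul_apply, ← Finset.sum_add_distrib, Finset.mul_sum, Finset.mul_sum,
      ← Finset.sum_add_distrib, ← Finset.sum_add_distrib]
    refine Finset.sum_congr rfl fun k _ => ?_
    rw [matQ_one_apply, ginv, Matrix.of_apply]
    ring
  rw [expand, h0, h1, h2]
  simp only [Matrix.sub_apply, Matrix.of_apply, Matrix.smul_apply, Matrix.one_apply, smul_eq_mul,
    kerVec]
  split_ifs <;> ring

theorem ginv_sum (h : GinvIdentities n) (t : ℝ) (i : Fin n) : ∑ j, ginv n t i j = 0 := by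
  have h0 := congrArg (Int.cast : ℤ → ℝ) (h.sum_const i)
  have h1 := congrArg (Int.cast : ℤ → ℝ) (h.sum_lin i)
  push_cast at h0 h1
  simp only [ginv, Matrix.of_apply]
  rw [Finset.sum_add_distrib, ← Finset.mul_sum, h0, h1]
  ring

theorem kerVec_vecMul (h : GinvIdentities n) (t : ℝ) : kerVec n t ᵥ* matQ n 1 t = 0 := by
  ext j
  have h0 := congrArg (Int.cast : ℤ → ℝ) (h.ker_const j)
  have h1 := congrArg (Int.cast : ℤ → ℝ) (h.ker_lin j)
  have h2 := congrArg (Int.cast : ℤ → ℝ) (h.ker_quad j)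
  push_cast at h0 h1 h2
  simp only [Matrix.vecMul, dotProduct, Pi.zero_apply]
  calc _ = ∑ i : Fin n, (kerConst (pos n i) : ℝ) * (skewMat n (upperConst n) i j : ℝ) +
        t * ∑ i : Fin n, ((kerConst (pos n i) : ℝ) * (skewMat n (upperLin n) i j : ℝ) +
          (kerLin (pos n i) : ℝ) * (skewMat n (upperConst n) i j : ℝ)) +
        t ^ 2 * ∑ i : Fin n, (kerLin (pos n i) : ℝ) * (skewMat n (upperLin n) i j : ℝ) := by
        rw [Finset.mul_sum, Finset.mul_sum, ← Finset.sum_add_distrib, ← Finset.sum_add_distrib]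
        refine Finset.sum_congr rfl fun k _ => ?_
        rw [matQ_one_apply, kerVec]
        ring
    _ = 0 := by rw [h0, h1, h2]; ring

theorem kerVec_sum (h : GinvIdentities n) (t : ℝ) : ∑ i, kerVec n t i = 4 + (n - 4) * t := by
  have h0 := congrArg (Int.cast : ℤ → ℝ) h.ker_sum_const
  have h1 := congrArg (Int.cast : ℤ → ℝ) h.ker_sum_lin
  push_cast at h0 h1
  simp only [kerVec]
  rw [Finset.sum_add_distrib, ← Finset.mul_sum, h0, h1]
  ring

/-- The transpose of `ginv_mul`: both factors are skew, so the signs cancel. -/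
theorem mul_ginv (h : GinvIdentities n) (t : ℝ) :
    matQ n 1 t * ginv n t =
      Matrix.of (fun _ j => kerVec n t j) - (4 + (n - 4) * t) • (1 : Matrix (Fin n) (Fin n) ℝ) := by
  have := congrArg Matrix.transpose (h.ginv_mul t)
  rw [Matrix.transpose_mul, matQ_transpose, ginv_transpose, neg_mul_neg] at this
  rw [this, Matrix.transpose_sub, Matrix.transpose_smul, Matrix.transpose_one]
  rfl

/-- A left null vector of `Q(n, 1, t)` is a multiple of the kernel vector. -/
theorem smul_eq_of_vecMul_eq_zero (h : GinvIdentities n) (t : ℝ) {x : Fin n → ℝ}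
    (hx : x ᵥ* matQ n 1 t = 0) (k : Fin n) :
    (4 + (n - 4) * t) * x k = (∑ i, x i) * kerVec n t k := by
  have h1 : x ᵥ* (matQ n 1 t * ginv n t) = 0 := by
    rw [← Matrix.vecMul_vecMul, hx, Matrix.zero_vecMul]
  rw [h.mul_ginv, Matrix.vecMul_sub, Matrix.vecMul_smul, Matrix.vecMul_one] at h1
  have h2 := congrFun h1 k
  simp only [Pi.sub_apply, Pi.smul_apply, smul_eq_mul, Pi.zero_apply, Matrix.vecMul, dotProduct,
    Matrix.of_apply, ← Finset.sum_mul] at h2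
  linarith

end GinvIdentities

theorem vecMul_onesCol {n : ℕ} (A : Matrix (Fin n) (Fin n) ℝ) (j k : Fin n) (x : Fin n → ℝ) :
    (x ᵥ* onesCol A j) k = if k = j then ∑ i, x i else (x ᵥ* A) k := by
  simp only [onesCol, Matrix.vecMul, dotProduct, Matrix.updateCol_apply]
  split_ifs <;> simp

/-! ### Size estimates -/

/-- The entries are `2 - t` (middle index), `1` (first and last) and `t` (all others). -/
theorem abs_le_abs_kerVec {n : ℕ} {t : ℝ} (ht : |t| ≤ 1) (i : Fin n) : |t| ≤ |kerVec n t i| := by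
  obtain ⟨h1, h2⟩ := abs_le.1 ht
  unfold kerVec kerConst kerLin
  split_ifs with h h'
  · push_cast
    rw [abs_of_nonneg (a := 2 + t * -1) (by linarith)]
    linarith
  · simpa using ht
  · simp

/-- The constant part is at most `2n` in modulus and the linear part contributes at most `1`. -/
theorem abs_upper_ginv_le {n a b : ℕ} (hn : 5 ≤ n) {t : ℝ} (ht : n * |t| ≤ 1) (hab : a < b)
    (hb : b < n) : |(ginvConst n a b : ℝ) + t * (ginvLin n a b : ℝ)| ≤ 3 * n := by
  have hn' : (5 : ℝ) ≤ n := by exact_mod_cast hn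
  have hab' : (a : ℝ) + 1 ≤ b := by exact_mod_cast hab
  have hb' : (b : ℝ) + 1 ≤ n := by exact_mod_cast hb
  have ha' : (0 : ℝ) ≤ a := a.cast_nonneg
  have key : ∀ z : ℝ, |z| ≤ n → |t * z| ≤ 1 := fun z hz => by
    rw [abs_mul]
    nlinarith [abs_nonneg t]
  unfold ginvConst ginvLin
  split_ifs with h0 h1 h2 h3 <;> push_cast
  · rw [abs_le]; constructor <;> linarith
  · rw [abs_le]; constructor <;> linarith
  · have h4 : (3 : ℝ) ≤ b := by
      have : 3 ≤ b := by omega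
      exact_mod_cast this
    have := abs_le.1 (key (-(2 * (b : ℝ) - n - 2)) (abs_le.2 ⟨by linarith, by linarith⟩))
    rw [abs_le]; constructor <;> linarith [this.1, this.2]
  · rw [abs_le]; constructor <;> linarith
  · have h4 : (3 : ℝ) ≤ a := by
      have : 3 ≤ a := by omega
      exact_mod_cast this
    have := abs_le.1 (key (2 * ((b : ℝ) - a) - (n - 4)) (abs_le.2 ⟨by linarith, by linarith⟩))
    rw [abs_le]; constructor <;> linarith [this.1, this.2]

theorem abs_ginv_le {n : ℕ} (hn : 5 ≤ n) {t : ℝ} (ht : n * |t| ≤ 1) (i j : Fin n) :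
    |ginv n t i j| ≤ 3 * n := by
  have hi : pos n i < n := Nat.mod_lt _ (by omega)
  have hj : pos n j < n := Nat.mod_lt _ (by omega)
  simp only [ginv, skewMatPos, skewExt, Matrix.of_apply]
  split_ifs with h h'
  · exact abs_upper_ginv_le hn ht h hj
  · rw [← abs_neg]
    convert abs_upper_ginv_le hn ht h' hi using 2
    push_cast
    ring
  · simp

/-! ### Nonsingularity, uniqueness and the bound -/

theorem mainTheorem7 (n : ℕ) (hodd : Odd n) (hn5 : 5 ≤ n) (hn19 : n ≤ 19)
    (κ s : ℝ) (hκ : 0 < κ) (hs : s ≠ 0) (hsκ : |s| / κ ≤ 1 / (n : ℝ)) :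
    (∀ j : Fin n, IsUnit (onesCol (matQ n κ s) j)) ∧
    (∃ π : Fin n → ℝ,
      (π ∈ sumOne n ∧ Matrix.vecMul π (matQ n κ s) = 0) ∧
      (∀ x : Fin n → ℝ, x ∈ sumOne n ∧ Matrix.vecMul x (matQ n κ s) = 0 → x = π) ∧
      varphi (matQ n κ s) π ≤ (4 * (n : ℝ) ^ 2 + 1) / (3 * |s|)) := by
  have hI := ginvIdentities hodd hn5 hn19
  have hn' : (5 : ℝ) ≤ n := by exact_mod_cast hn5
  obtain ⟨t, rfl⟩ : ∃ t, s = κ * t := ⟨s / κ, by field_simp⟩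
  have ht0 : t ≠ 0 := right_ne_zero_of_mul hs
  have htpos : 0 < |t| := abs_pos.2 ht0
  have ht : n * |t| ≤ 1 := by
    rw [abs_mul, abs_of_pos hκ, mul_div_cancel_left₀ _ hκ.ne', le_div_iff₀ (by linarith)] at hsκ
    linarith
  have ht1 : |t| ≤ 1 := by nlinarith
  set σ : ℝ := 4 + (n - 4) * t with hσdef
  -- Even for negative `t`, `(n-4)|t| < 1`.
  have hσ : 0 < σ := by nlinarith [neg_abs_le t]
  have hp : ∀ i, kerVec n t i ≠ 0 := fun i =>
    abs_pos.1 (htpos.trans_le (abs_le_abs_kerVec ht1 i))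
  have hnull : ∀ x : Fin n → ℝ, x ᵥ* matQ n κ (κ * t) = 0 →
      ∀ k, σ * x k = (∑ i, x i) * kerVec n t k := by
    intro x hx
    rw [matQ_mul, Matrix.vecMul_smul, smul_eq_zero] at hx
    exact hI.smul_eq_of_vecMul_eq_zero t (hx.resolve_left hκ.ne')
  have hker : kerVec n t ᵥ* matQ n κ (κ * t) = 0 := by
    rw [matQ_mul, Matrix.vecMul_smul, hI.kerVec_vecMul, smul_zero]
  have hker' : matQ n κ (κ * t) *ᵥ kerVec n t = 0 := by
    rw [← Matrix.vecMul_transpose, matQ_transpose, Matrix.vecMul_neg, hker, neg_zero]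
  have hunit : ∀ j : Fin n, IsUnit (onesCol (matQ n κ (κ * t)) j) := by
    intro j
    rw [← Matrix.vecMul_injective_iff_isUnit]
    refine (injective_iff_map_eq_zero
      (Matrix.vecMulLinear (onesCol (matQ n κ (κ * t)) j))).2 fun x hx => ?_
    rw [Matrix.vecMulLinear_apply] at hx
    have hx' := fun k => (vecMul_onesCol (matQ n κ (κ * t)) j k x).symm.trans (congrFun hx k)
    have hsum : ∑ i, x i = 0 := by simpa using hx' j
    have hoff : ∀ k, k ≠ j → (x ᵥ* matQ n κ (κ * t)) k = 0 := fun k hk => by simpa [hk] using hx' k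
    -- `x Q` is supported at `j`; pairing it with the right null vector `p`, whose entries are
    -- nonzero, kills that last entry.
    have hdot : (x ᵥ* matQ n κ (κ * t)) ⬝ᵥ kerVec n t = 0 := by
      rw [← Matrix.dotProduct_mulVec, hker', dotProduct_zero]
    rw [dotProduct, Finset.sum_eq_single j (fun k _ hk => by rw [hoff k hk, zero_mul])
      (by simp)] at hdot
    have hxQ : x ᵥ* matQ n κ (κ * t) = 0 := by
      ext k
      by_cases hk : k = j
      · subst hk
        exact (mul_eq_zero.1 hdot).resolve_right (hp k)
      · exact hoff k hk
    ext k
    have := hnull x hxQ k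
    rw [hsum, zero_mul] at this
    exact (mul_eq_zero.1 this).resolve_left hσ.ne'
  have hsumπ : ∑ i, (σ⁻¹ • kerVec n t) i = 1 := by
    simp only [Pi.smul_apply, smul_eq_mul, ← Finset.mul_sum]
    rw [hI.kerVec_sum, inv_mul_cancel₀ hσ.ne']
  refine ⟨hunit, σ⁻¹ • kerVec n t, ⟨hsumπ, ?_⟩, ?_, ?_⟩
  · rw [Matrix.smul_vecMul, hker, smul_zero]
  · rintro x ⟨hx1, hx2⟩
    ext k
    have h1 : ∑ i, x i = 1 := hx1
    have := hnull x hx2 k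
    rw [h1, one_mul] at this
    rw [Pi.smul_apply, smul_eq_mul, ← this, inv_mul_cancel_left₀ hσ.ne']
  · have hsol : ∀ j : Fin n, 1 ᵥ* (onesCol (matQ n κ (κ * t)) j)⁻¹ =
        σ⁻¹ • kerVec n t + (κ * kerVec n t j)⁻¹ • ginv n t j := by
      intro j
      have hrow : ∀ k, (ginv n t j ᵥ* matQ n 1 t) k =
          kerVec n t j - if j = k then σ else 0 := by
        intro k
        have := congrFun (congrFun (hI.ginv_mul t) j) k
        rw [Matrix.mul_apply_eq_vecMul] at this
        rw [this]
        simp [Matrix.one_apply, hσdef]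
      -- Column `j` tests the coordinate sum, to which `G` contributes nothing; in the other columns
      -- only the row of `G` contributes, giving `κ p_j / (κ p_j)`.
      have hmul : (σ⁻¹ • kerVec n t + (κ * kerVec n t j)⁻¹ • ginv n t j) ᵥ*
          onesCol (matQ n κ (κ * t)) j = 1 := by
        ext k
        rw [vecMul_onesCol]
        split_ifs with hk
        · simp only [Pi.add_apply, Finset.sum_add_distrib, hsumπ]
          simp only [Pi.smul_apply, smul_eq_mul, ← Finset.mul_sum, hI.ginv_sum, mul_zero, add_zero,
            Pi.one_apply]
        · rw [Matrix.add_vecMul, Matrix.smul_vecMul, Matrix.smul_vecMul, hker, smul_zero, zero_add,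
            matQ_mul, Matrix.vecMul_smul]
          simp only [Pi.smul_apply, smul_eq_mul, hrow, if_neg (Ne.symm hk), sub_zero, Pi.one_apply]
          have := hp j
          field_simp
      have hdet := (Matrix.isUnit_iff_isUnit_det _).1 (hunit j)
      rw [← hmul, Matrix.vecMul_vecMul, Matrix.mul_nonsing_inv _ hdet, Matrix.vecMul_one]
    have : Nonempty (Fin n) := ⟨⟨0, by omega⟩⟩
    refine ciSup_le fun j => ciSup_le fun i => ?_
    rw [hsol, add_sub_cancel_left, Pi.smul_apply, smul_eq_mul, abs_mul, abs_inv, abs_mul, abs_mul,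
      abs_of_pos hκ]
    calc (κ * |kerVec n t j|)⁻¹ * |ginv n t j i| ≤ (κ * |t|)⁻¹ * (3 * n) := by
          have hle : κ * |t| ≤ κ * |kerVec n t j| := by
            gcongr κ * ?_
            exact abs_le_abs_kerVec ht1 j
          exact mul_le_mul (inv_anti₀ (by positivity) hle) (abs_ginv_le hn5 ht j i)
            (abs_nonneg _) (by positivity)
      _ = 9 * n / (3 * (κ * |t|)) := by
          field_simp
          norm_num
      _ ≤ (4 * (n : ℝ) ^ 2 + 1) / (3 * (κ * |t|)) := by
          gcongr
          -- `9n ≤ 4n² + 1` since `n ≥ 5`.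
          nlinarith
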